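/- All graphs are finite and simple. For a graph $G=(V,E)$ with $n\ge 2$ vertices and a nonempty set $S\subseteq V$ put $h(S)=e(S,V\setminus S)/|S|$, where $e(S,V\setminus S)$ is the number of edges with exactly one endpoint in $S$, and let the Cheeger constant of $G$ be $$h(G)=\min\{h(S): \emptyset\neq S\subseteq V,\ |S|\le n/2\}.$$ The contraction clique number $\mathrm{ccl}(G)$ is the largest integer $r$ such that the complete graph $K_r$ is a minor of $G$, i.e. such that there are $r$ pairwise disjoint sets $T_1,\dots,T_r\subseteq V$, each inducing a (nonempty) connected subgraph of $G$, with at least one edge of $G$ between $T_i$ and $T_j$ for all $i\neq j$. Theorem. For every $\varepsilon>0$ there exist $\beta>0$ and $n_0\in\mathbb{N}$ such that the following holds. Let $d\ge 3$ be an integer and let $G$ be a graph with $n\ge n_0$ vertices and maximum degree at most $d$. If $h(G)\ge\varepsilon d$, then $$\mathrm{ccl}(G)\ge\beta\sqrt{n}.$$ -/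

import Mathlib

namespace SimpleGraph

/-- `H` is a minor of `G`: there are pairwise disjoint branch sets `T h ⊆ V(G)`, one for every
vertex `h` of `H`, each inducing a (nonempty) connected subgraph of `G`, with an edge of `G`
between `T h` and `T h'` whenever `h` and `h'` are adjacent in `H`. -/
def IsMinorOf {W V : Type*} (H : SimpleGraph W) (G : SimpleGraph V) : Prop :=
  ∃ T : W → Set V,
    (∀ h, (G.induce (T h)).Connected) ∧
    (∀ h h', h ≠ h' → Disjoint (T h) (T h')) ∧
    (∀ h h', H.Adj h h' → ∃ x ∈ T h, ∃ y ∈ T h', G.Adj x y)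

/-- The contraction clique number: the largest `r` such that `K_r` is a minor of `G`. -/
noncomputable def ccl {V : Type*} (G : SimpleGraph V) : ℕ :=
  sSup {r : ℕ | IsMinorOf (⊤ : SimpleGraph (Fin r)) G}

/-- The edge-expansion `e(S, V ∖ S) / |S|` of a vertex set `S`. -/
noncomputable def edgeExpansion {V : Type*} [Fintype V] [DecidableEq V]
    (G : SimpleGraph V) [DecidableRel G.Adj] (S : Finset V) : ℝ :=
  ((G.interedges S Sᶜ).card : ℝ) / (S.card : ℝ)

/-- The Cheeger constant: the smallest edge-expansion of a nonempty vertex set with at most half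
of the vertices. -/
noncomputable def cheegerConstant {V : Type*} [Fintype V] [DecidableEq V]
    (G : SimpleGraph V) [DecidableRel G.Adj] : ℝ :=
  sInf {x : ℝ | ∃ S : Finset V, S.Nonempty ∧ (S.card : ℝ) ≤ (Fintype.card V : ℝ) / 2 ∧
    x = G.edgeExpansion S}

/-- In a finite graph the supremum defining `ccl` is a maximum. -/
theorem isGreatest_ccl {V : Type*} [Finite V] (G : SimpleGraph V) :
    IsGreatest {r : ℕ | IsMinorOf (⊤ : SimpleGraph (Fin r)) G} G.ccl := by
  have hne : {r : ℕ | IsMinorOf (⊤ : SimpleGraph (Fin r)) G}.Nonempty :=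
    ⟨0, fun i => i.elim0, fun i => i.elim0, fun i => i.elim0, fun i => i.elim0⟩
  have hb : BddAbove {r : ℕ | IsMinorOf (⊤ : SimpleGraph (Fin r)) G} := by
    refine ⟨Nat.card V, ?_⟩
    rintro r ⟨T, hc, hd, -⟩
    choose f hf using fun i => Set.nonempty_coe_sort.1 (hc i).nonempty
    have hinj : Function.Injective f := by
      intro i j hij
      by_contra hne
      exact Set.disjoint_left.1 (hd i j hne) (hf i) (hij ▸ hf j)
    simpa using Nat.card_le_card_of_injective f hinj
  exact ⟨Nat.sSup_mem hne hb, fun r hr => le_csSup hb hr⟩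

/-- In a graph with at least two vertices the infimum defining the Cheeger constant is a
minimum. -/
theorem isLeast_cheegerConstant {V : Type*} [Fintype V] [DecidableEq V]
    (G : SimpleGraph V) [DecidableRel G.Adj] (hV : 2 ≤ Fintype.card V) :
    IsLeast {x : ℝ | ∃ S : Finset V, S.Nonempty ∧ (S.card : ℝ) ≤ (Fintype.card V : ℝ) / 2 ∧
      x = G.edgeExpansion S} G.cheegerConstant := by
  have hfin : {x : ℝ | ∃ S : Finset V, S.Nonempty ∧
      (S.card : ℝ) ≤ (Fintype.card V : ℝ) / 2 ∧ x = G.edgeExpansion S}.Finite :=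
    (Set.finite_range G.edgeExpansion).subset (by rintro x ⟨S, -, -, rfl⟩; exact ⟨S, rfl⟩)
  have hne : {x : ℝ | ∃ S : Finset V, S.Nonempty ∧
      (S.card : ℝ) ≤ (Fintype.card V : ℝ) / 2 ∧ x = G.edgeExpansion S}.Nonempty := by
    obtain ⟨v⟩ : Nonempty V := Fintype.card_pos_iff.1 (by omega)
    have h2 : (2 : ℝ) ≤ (Fintype.card V : ℝ) := by exact_mod_cast hV
    exact ⟨_, {v}, Finset.singleton_nonempty v, by simp; linarith, rfl⟩
  exact ⟨hne.csInf_mem hfin, fun x hx => csInf_le hfin.bddBelow hx⟩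

end SimpleGraph

/-!
A graph with `h(G) ≥ ε d` and maximum degree at most `d` is an edge expander (`IsEdgeExpander`).
Write `n` for its number of vertices and let `s` be about `√n`. The clique minor is grown one branch
set at a time, each a connected set of size between `s` and `O(s)`.

The engine is `IsEdgeExpander.exists_connected_meeting`: in an expander on at most `s²` vertices,
any `s` sets of size `Ω(s)` are met by one connected set of size `O(s)`. Take a lazy random walk of
length `s` from a uniformly random vertex. It misses a fixed set `A` with probability
`O(N / (s |A|))`, where `N` is the number of vertices (`sum_avoidProb_le`). For a set `U` of size
`Ω(s)`, the `k`-th thickening grows geometrically in `k` up to size `N / 2`, and its complement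
shrinks geometrically from then on. So the expected distance from the walk to `U`, being the sum
over `k` of the probabilities of missing the `k`-th thickening, is `O(1)`
(`sum_sum_avoidProb_thickening_le`). Hence some walk has total distance `O(s)` to all the given
sets, and adding shortest paths yields the connected set.

The bound on the probability of missing `A` needs no spectral theory. The expected hitting time
`h` of `A`, truncated at the length of the walk, has Laplacian at most `d` off `A`, so by Green's
identity the total drop of `h` along the edges leaving a superlevel set `S` is at most `d |S|`.
Expansion supplies many such edges, hence many vertices just below the level (`le_card_layer`), so
the superlevel sets grow quickly as the level falls, and the average of `h` is `O(N / |A|)`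
(`sum_le_of_laplacian_le`).

To use this repeatedly, keep a set `D` of discarded vertices which sends few edges to the set of
remaining vertices (`IsPartialMinor`). A branch set with few edges to the remaining vertices, or a
set of at most half of the remaining vertices that expands badly among them, may be moved to `D`.
Since the branch sets occupy only a small fraction of the vertices, expansion of `G` forces
`|D| ≤ n / 4` at all times (`four_mul_card_discarded_le`). In a configuration maximizing
`2 |D| + #(branch sets)` no such move is possible, so the remaining vertices induce an expander in
which every branch set has `Ω(s)` neighbours, and a further branch set could be added unless there
are already `β √n` of them.
-/

namespace SimpleGraph

open Finset

/-! ### Edge expansion and superlevel sets -/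

section

theorem card_interedges_symm {V : Type*} {G : SimpleGraph V} [DecidableRel G.Adj]
    (S T : Finset V) :
    #(G.interedges S T) = #(G.interedges T S) := by
  have : Std.Symm G.Adj := ⟨fun _ _ h => h.symm⟩
  exact Rel.card_interedges_comm S T

theorem card_interedges_union_left {V : Type*} [DecidableEq V] {G : SimpleGraph V}
    [DecidableRel G.Adj] {S₁ S₂ : Finset V} (h : Disjoint S₁ S₂) (T : Finset V) :
    #(G.interedges (S₁ ∪ S₂) T) = #(G.interedges S₁ T) + #(G.interedges S₂ T) := by
  rw [← card_union_of_disjoint (interedges_disjoint_left G h T)]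
  congr 1
  ext p
  simp only [mem_union, mem_interedges_iff]
  tauto

variable {V : Type*} [Fintype V] [DecidableEq V] {G : SimpleGraph V} [DecidableRel G.Adj]

theorem card_interedges_union_right {V : Type*} [DecidableEq V] {G : SimpleGraph V}
    [DecidableRel G.Adj] (S : Finset V) {T₁ T₂ : Finset V} (h : Disjoint T₁ T₂) :
    #(G.interedges S (T₁ ∪ T₂)) = #(G.interedges S T₁) + #(G.interedges S T₂) := by
  rw [card_interedges_symm, card_interedges_union_left h, card_interedges_symm T₁,
    card_interedges_symm T₂]

theorem card_interedges_le_left {d : ℕ} (hd : ∀ v, G.degree v ≤ d) (S T : Finset V) :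
    #(G.interedges S T) ≤ #S * d := by
  have : G.interedges S T ⊆ (S.sigma fun v => G.neighborFinset v).image
      (fun p : (Σ _ : V, V) => (p.1, p.2)) := by
    intro p hp
    rw [mem_interedges_iff] at hp
    simp only [mem_image, mem_sigma, mem_neighborFinset]
    exact ⟨⟨p.1, p.2⟩, ⟨hp.1, hp.2.2⟩, rfl⟩
  refine (card_le_card this).trans (card_image_le.trans ?_)
  rw [card_sigma]
  exact sum_le_card_nsmul _ _ _ fun v _ => hd v

theorem card_interedges_le_right {d : ℕ} (hd : ∀ v, G.degree v ≤ d) (S T : Finset V) :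
    #(G.interedges S T) ≤ #T * d := by
  rw [card_interedges_symm]
  exact card_interedges_le_left hd T S

/-- Green's identity: summing the differences `h v - h w` over all edges leaving vertices of `S`,
the edges inside `S` cancel. -/
theorem sum_sum_neighborFinset_sub (h : V → ℝ) (S : Finset V) :
    ∑ v ∈ S, ∑ w ∈ G.neighborFinset v, (h v - h w) =
      ∑ p ∈ G.interedges S Sᶜ, (h p.1 - h p.2) := by
  have key (T : Finset V) : ∑ p ∈ G.interedges S T, (h p.1 - h p.2) =
      ∑ v ∈ S, ∑ w ∈ T, (if G.Adj v w then h v - h w else 0) := by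
    rw [interedges_def, sum_filter, sum_product]
  have hin : ∑ v ∈ S, ∑ w ∈ S, (if G.Adj v w then h v - h w else 0) = 0 := by
    have := sum_comm (s := S) (t := S) (f := fun v w => if G.Adj v w then h v - h w else 0)
    have h2 : ∑ v ∈ S, ∑ w ∈ S, (if G.Adj w v then h w - h v else 0) =
        - ∑ v ∈ S, ∑ w ∈ S, (if G.Adj v w then h v - h w else 0) := by
      simp only [← sum_neg_distrib]
      refine sum_congr rfl fun v _ => sum_congr rfl fun w _ => ?_
      simp only [G.adj_comm w v]
      split_ifs <;> ring
    linarith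
  have hsplit : ∑ v ∈ S, ∑ w ∈ G.neighborFinset v, (h v - h w) =
      ∑ v ∈ S, ∑ w ∈ S, (if G.Adj v w then h v - h w else 0) +
        ∑ v ∈ S, ∑ w ∈ Sᶜ, (if G.Adj v w then h v - h w else 0) := by
    rw [← sum_add_distrib]
    refine sum_congr rfl fun v _ => ?_
    rw [sum_add_sum_compl S, ← sum_filter]
    congr 1
    ext w
    simp
  rw [hsplit, hin, zero_add, key]

/-- `G` has maximum degree at most `d`, and every vertex set and its complement are joined by at
least `c * d` edges per vertex of the smaller of the two. The ranges `0 < c ≤ 1` and `0 < d` of the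
parameters are part of the notion. -/
structure IsEdgeExpander (G : SimpleGraph V) [DecidableRel G.Adj] (c : ℝ) (d : ℕ) : Prop where
  c_pos : 0 < c
  c_le_one : c ≤ 1
  d_pos : 0 < d
  degree_le : ∀ v, G.degree v ≤ d
  le_card_interedges : ∀ S : Finset V,
    c * d * min (#S : ℝ) (#Sᶜ : ℝ) ≤ #(G.interedges S Sᶜ)

/-- If at least `c * d * m` edges leave the superlevel set `{t < h}` of a function whose Laplacian
is at most `d` there, then `h` drops by at most `δ` along at least half of them, so the layer
just below level `t` has at least `c * m / 2` vertices. -/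
theorem le_card_layer {d : ℕ} (hd0 : 0 < d) (hd : ∀ v, G.degree v ≤ d) {c m δ t : ℝ}
    (hδ : 0 < δ) {h : V → ℝ}
    (hsup : ∀ v, t < h v → ∑ w ∈ G.neighborFinset v, (h v - h w) ≤ d)
    (hm : c * d * m ≤ #(G.interedges ({v | t < h v} : Finset V) ({v | t < h v} : Finset V)ᶜ))
    (hδm : 2 * (#({v | t < h v} : Finset V) : ℝ) ≤ δ * (c * m)) :
    c * m / 2 ≤ #({v | t - δ < h v ∧ h v ≤ t} : Finset V) := by
  set S : Finset V := {v | t < h v} with hS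
  set M : Finset V := {v | t - δ < h v ∧ h v ≤ t} with hM
  set R : Finset V := {v | h v ≤ t - δ} with hR
  have hd0' : (0 : ℝ) < d := by exact_mod_cast hd0
  have hMR : Sᶜ = M ∪ R := by
    ext v
    simp only [hS, hM, hR, mem_compl, mem_filter, mem_univ, true_and, mem_union, not_lt]
    constructor
    · intro h1
      by_cases h2 : h v ≤ t - δ
      · exact Or.inr h2
      · exact Or.inl ⟨not_le.1 h2, h1⟩
    · rintro (h1 | h1)
      · exact h1.2
      · linarith
  have hdisj : Disjoint M R := by
    rw [Finset.disjoint_left]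
    intro v h1 h2
    simp only [hM, hR, mem_filter, mem_univ, true_and] at h1 h2
    linarith
  have hsplit := card_interedges_union_right (G := G) S hdisj
  rw [← hMR] at hsplit
  have hle : (#(G.interedges S M) : ℝ) ≤ #M * d := by
    exact_mod_cast card_interedges_le_right hd S M
  have hsum : ∑ p ∈ G.interedges S Sᶜ, (h p.1 - h p.2) ≤ #S * d := by
    rw [← sum_sum_neighborFinset_sub, ← nsmul_eq_mul]
    refine sum_le_card_nsmul _ _ _ fun v hv => hsup v ?_
    simpa [hS] using hv
  have hR2 : #(G.interedges S R) * δ ≤ ∑ p ∈ G.interedges S Sᶜ, (h p.1 - h p.2) := by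
    have hsub : G.interedges S R ⊆ G.interedges S Sᶜ :=
      G.interedges_mono (subset_refl _) (hMR ▸ subset_union_right)
    refine le_trans ?_ (sum_le_sum_of_subset_of_nonneg hsub ?_)
    · rw [← nsmul_eq_mul]
      refine card_nsmul_le_sum _ _ _ fun p hp => ?_
      rw [mem_interedges_iff] at hp
      have h1 : t < h p.1 := by simpa [hS] using hp.1
      have h2 : h p.2 ≤ t - δ := by simpa [hR] using hp.2.1
      linarith
    · intro p hp _
      rw [mem_interedges_iff] at hp
      have h1 : t < h p.1 := by simpa [hS] using hp.1
      have h2 : h p.2 ≤ t := by simpa [hS] using hp.2.1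
      linarith
  have hsplit' : (#(G.interedges S Sᶜ) : ℝ) = #(G.interedges S M) + #(G.interedges S R) := by
    exact_mod_cast hsplit
  rw [hsplit'] at hm
  have h1 : (c * m) * (δ * d) ≤ (#M : ℝ) * (δ * d) + δ * (c * m) / 2 * d := by
    nlinarith
  have h2 : (c * m / 2) * (δ * d) ≤ (#M : ℝ) * (δ * d) := by nlinarith
  exact le_of_mul_le_mul_right h2 (by positivity)

namespace IsEdgeExpander

variable {c : ℝ} {d : ℕ}

/-- Some level of height `O(N / b)` already has half of the vertices below it, where `b` is the
number of vertices below the starting level. -/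
theorem exists_level_half (hG : G.IsEdgeExpander c d) {h : V → ℝ} (t : ℝ)
    (hsup : ∀ v, t < h v → ∑ w ∈ G.neighborFinset v, (h v - h w) ≤ d)
    (hpos : 0 < #({v | h v ≤ t} : Finset V)) :
    ∃ t' : ℝ, t ≤ t' ∧
      t' ≤ t + 6 * Fintype.card V / (c ^ 2 * #({v | h v ≤ t} : Finset V)) ∧
      2 * #({v | t' < h v} : Finset V) ≤ Fintype.card V := by
  have hc := hG.c_pos
  have hc1 := hG.c_le_one
  induction hk : Fintype.card V - #({v | h v ≤ t} : Finset V) using Nat.strong_induction_on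
    generalizing t with
  | _ k ih =>
  set N : ℝ := (Fintype.card V : ℝ) with hN
  set b : ℝ := (#({v | h v ≤ t} : Finset V) : ℝ) with hb
  have hb0 : 0 < b := by rw [hb]; exact_mod_cast hpos
  have hN0 : 0 < N := by
    refine hb0.trans_le ?_
    rw [hb, hN]
    exact_mod_cast card_le_univ _
  -- Raising the level by `δ` multiplies the number of vertices below it by `1 + c / 2`, so the
  -- increments needed decrease geometrically; their sum is at most `δ * (3 / c)`.
  set δ : ℝ := 2 * N / (c * b) with hδ
  have hδ0 : 0 < δ := by positivity
  have hδ1 : δ * (c * b) = 2 * N := by rw [hδ]; field_simp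
  have hbudget : 6 * N / (c ^ 2 * b) = δ * (3 / c) := by rw [hδ]; field_simp; ring
  have h3c : 3 ≤ 3 / c := by rw [le_div_iff₀ hc]; linarith
  by_cases hhalf : 2 * #({v | t + δ < h v} : Finset V) ≤ Fintype.card V
  · refine ⟨t + δ, by linarith, ?_, hhalf⟩
    rw [hbudget]
    nlinarith
  · set S : Finset V := {v | t + δ < h v} with hS
    have hSc : Sᶜ = ({v | h v ≤ t + δ} : Finset V) := by
      ext v; simp [hS]
    have hcard : (#S : ℝ) + #Sᶜ = N := by
      rw [hN]; exact_mod_cast card_add_card_compl S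
    have hhalf' : N < 2 * #S := by
      rw [hN]; exact_mod_cast not_le.1 hhalf
    have hSN : (#S : ℝ) ≤ N := by
      rw [hN]; exact_mod_cast card_le_univ S
    have hbS : b ≤ #Sᶜ := by
      rw [hb, hSc]
      exact_mod_cast card_le_card (monotone_filter_right _ (fun v _ hv => by linarith))
    have hlayer := le_card_layer (G := G) (c := c) (m := b) (δ := δ) (t := t + δ) (h := h)
      hG.d_pos hG.degree_le hδ0 (fun v hv => hsup v (by linarith)) (by
        refine le_trans ?_ (hG.le_card_interedges S)
        refine mul_le_mul_of_nonneg_left (le_min (by linarith) hbS) ?_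
        positivity) (by rw [hδ1]; linarith)
    rw [add_sub_cancel_right] at hlayer
    set M : Finset V := {v | t < h v ∧ h v ≤ t + δ} with hM
    have hun : ({v | h v ≤ t + δ} : Finset V) = ({v | h v ≤ t} : Finset V) ∪ M := by
      ext v
      simp only [hM, mem_filter, mem_univ, true_and, mem_union]
      constructor
      · intro h1
        by_cases h2 : h v ≤ t
        · exact Or.inl h2
        · exact Or.inr ⟨not_le.1 h2, h1⟩
      · rintro (h1 | h1)
        · linarith
        · exact h1.2
    have hdis : Disjoint ({v | h v ≤ t} : Finset V) M := by
      rw [Finset.disjoint_left]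
      intro v h1 h2
      simp only [hM, mem_filter, mem_univ, true_and] at h1 h2
      linarith
    have hcb : (#({v | h v ≤ t + δ} : Finset V) : ℝ) = b + #M := by
      rw [hun, card_union_of_disjoint hdis]; push_cast; rfl
    have hMpos : 0 < #M := by
      have : (0 : ℝ) < #M := lt_of_lt_of_le (by positivity) hlayer
      exact_mod_cast this
    have hnat : #({v | h v ≤ t + δ} : Finset V) = #({v | h v ≤ t} : Finset V) + #M := by
      rw [hun, card_union_of_disjoint hdis]
    have hle := card_le_univ ({v | h v ≤ t + δ} : Finset V)
    obtain ⟨t', h1, h2, h3⟩ := ih _ (by omega) (t + δ) (fun v hv => hsup v (by linarith))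
      (by omega) rfl
    refine ⟨t', by linarith, h2.trans ?_, h3⟩
    rw [hbudget, hcb]
    have h4 : 6 * N / (c ^ 2 * (b + #M)) ≤ 6 * N / (c ^ 2 * (b + c * b / 2)) := by
      gcongr
    have h5 : 6 * N / (c ^ 2 * (b + c * b / 2)) = δ * (3 / c) * (2 / (2 + c)) := by
      rw [hδ]; field_simp; ring
    have h6 : 1 ≤ 3 / c * (1 - 2 / (2 + c)) := by
      have : 3 / c * (1 - 2 / (2 + c)) = 3 / (2 + c) := by field_simp; ring
      rw [this, le_div_iff₀ (by positivity)]
      linarith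
    nlinarith

/-- Above a level with at most half of the vertices above it, the superlevel sets shrink
geometrically, so the total excess is `O(N)`. -/
theorem sum_le_of_level_half (hG : G.IsEdgeExpander c d) {h : V → ℝ} {t : ℝ}
    (ht : 0 ≤ t)
    (hsup : ∀ v, t < h v → ∑ w ∈ G.neighborFinset v, (h v - h w) ≤ d)
    (hhalf : 2 * #({v | t < h v} : Finset V) ≤ Fintype.card V) :
    ∑ v, h v ≤ Fintype.card V * t + 3 * Fintype.card V / c ^ 2 := by
  have hc := hG.c_pos
  have hc1 := hG.c_le_one
  set N : ℝ := (Fintype.card V : ℝ) with hN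
  set φ : ℕ → ℝ := fun j => #({v | t + 2 / c * j < h v} : Finset V) with hφ
  have hhalf' : φ 0 ≤ N / 2 := by
    have : (2 * #({v | t < h v} : Finset V) : ℝ) ≤ N := by rw [hN]; exact_mod_cast hhalf
    simp only [hφ, Nat.cast_zero, mul_zero, add_zero]
    linarith
  have hanti (j : ℕ) : φ j ≤ φ 0 := by
    simp only [hφ]
    refine Nat.cast_le.2 (card_le_card (monotone_filter_right _ fun v _ hv => ?_))
    have : 0 ≤ 2 / c * (j : ℝ) := by positivity
    simp only [Nat.cast_zero, mul_zero, add_zero]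
    linarith
  have hshrink (j : ℕ) : c / 2 * φ (j + 1) ≤ φ j - φ (j + 1) := by
    set S : Finset V := {v | t + 2 / c * (j + 1 : ℕ) < h v} with hS
    have hj0 : 0 ≤ 2 / c * ((j + 1 : ℕ) : ℝ) := by positivity
    have hcard : (#S : ℝ) + #Sᶜ = N := by
      rw [hN]; exact_mod_cast card_add_card_compl S
    have hSφ : φ (j + 1) = #S := rfl
    have hS2 : (#S : ℝ) ≤ N / 2 := by rw [← hSφ]; exact (hanti _).trans hhalf'
    have hlayer := le_card_layer (G := G) (c := c) (m := #S) (δ := 2 / c)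
      (t := t + 2 / c * (j + 1 : ℕ)) (h := h)
      hG.d_pos hG.degree_le (by positivity) (fun v hv => hsup v (by linarith)) (by
        refine le_trans ?_ (hG.le_card_interedges S)
        refine mul_le_mul_of_nonneg_left (le_min le_rfl (by linarith)) ?_
        positivity) (by rw [← hS]; field_simp; exact le_rfl)
    have hlev : t + 2 / c * ((j + 1 : ℕ) : ℝ) - 2 / c = t + 2 / c * (j : ℝ) := by
      push_cast; ring
    rw [hlev] at hlayer
    set M : Finset V := {v | t + 2 / c * (j : ℝ) < h v ∧ h v ≤ t + 2 / c * (j + 1 : ℕ)} with hM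
    have hdis : Disjoint S M := by
      rw [Finset.disjoint_left]
      intro v h1 h2
      simp only [hS, hM, mem_filter, mem_univ, true_and] at h1 h2
      linarith
    have : (#S : ℝ) + #M ≤ φ j := by
      rw [← Nat.cast_add, ← card_union_of_disjoint hdis]
      refine Nat.cast_le.2 (card_le_card fun v hv => ?_)
      simp only [hS, hM, mem_union, mem_filter, mem_univ, true_and] at hv ⊢
      have : 0 < 2 / c := by positivity
      rcases hv with hv | hv
      · linarith
      · exact hv.1
    rw [hSφ]
    linarith
  have htel (j : ℕ) : c / 2 * ∑ i ∈ range j, φ (i + 1) ≤ φ 0 - φ j := by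
    rw [mul_sum]
    refine (sum_le_sum fun i _ => hshrink i).trans (le_of_eq ?_)
    exact sum_range_sub' φ j
  -- Layer-cake bound for the truncation of `h` at height `t + 2 / c * j`.
  have htrunc (j : ℕ) : ∑ v, min (h v) (t + 2 / c * j) ≤ N * t + 2 / c * ∑ i ∈ range j, φ i := by
    induction j with
    | zero =>
      simp only [Nat.cast_zero, mul_zero, add_zero, range_zero, sum_empty]
      rw [hN, ← nsmul_eq_mul]
      exact sum_le_card_nsmul _ _ _ fun v _ => min_le_right _ _
    | succ j ih =>
      rw [sum_range_succ, mul_add, ← add_assoc]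
      have hφs : 2 / c * φ j = ∑ v, if t + 2 / c * j < h v then 2 / c else 0 := by
        rw [← sum_filter, sum_const, nsmul_eq_mul, mul_comm]
      rw [hφs]
      refine le_trans ?_ (add_le_add ih le_rfl)
      rw [← sum_add_distrib]
      refine sum_le_sum fun v _ => ?_
      have h2c : 0 < 2 / c := by positivity
      split_ifs with hv
      · rw [min_eq_right hv.le]
        refine (min_le_right _ _).trans (le_of_eq ?_)
        push_cast; ring
      · rw [min_eq_left (not_lt.1 hv), add_zero]
        exact min_le_left _ _
  obtain ⟨H, hH⟩ : ∃ H : ℝ, ∀ v, h v ≤ H := by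
    obtain ⟨H, hH⟩ := (Set.finite_range h).bddAbove
    exact ⟨H, fun v => hH ⟨v, rfl⟩⟩
  obtain ⟨J, hJ⟩ := exists_nat_ge (H * (c / 2))
  have hfin : ∑ v, h v = ∑ v, min (h v) (t + 2 / c * J) := by
    refine sum_congr rfl fun v _ => (min_eq_left ?_).symm
    have : 2 / c * (H * (c / 2)) ≤ 2 / c * J := by gcongr
    have h2 : 2 / c * (H * (c / 2)) = H := by field_simp
    linarith [hH v]
  rw [hfin]
  refine (htrunc J).trans ?_
  have hφ0 (j : ℕ) : 0 ≤ φ j := Nat.cast_nonneg _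
  have hsum : ∑ i ∈ range J, φ i ≤ φ 0 + ∑ i ∈ range J, φ (i + 1) := by
    rw [add_comm, ← sum_range_succ' φ J]
    exact sum_le_sum_of_subset_of_nonneg (range_subset_range.2 (Nat.le_succ J)) fun i _ _ => hφ0 i
  have h7 : ∑ i ∈ range J, φ (i + 1) ≤ 2 / c * φ 0 := by
    have := htel J
    have h8 : 2 / c * (c / 2 * ∑ i ∈ range J, φ (i + 1)) ≤ 2 / c * (φ 0 - φ J) := by gcongr
    rw [← mul_assoc] at h8
    have h9 : 2 / c * (c / 2) = 1 := by field_simp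
    rw [h9, one_mul] at h8
    refine h8.trans ?_
    gcongr
    linarith [hφ0 J]
  have h10 : 2 / c * ∑ i ∈ range J, φ i ≤ 2 / c * ((1 + 2 / c) * (N / 2)) := by
    gcongr
    have : (1 + 2 / c) * φ 0 ≤ (1 + 2 / c) * (N / 2) := by gcongr
    linarith
  have h11 : 2 / c * ((1 + 2 / c) * (N / 2)) ≤ 3 * N / c ^ 2 := by
    have : 2 / c * ((1 + 2 / c) * (N / 2)) = (c + 2) * N / c ^ 2 := by field_simp
    rw [this]
    have hN0 : 0 ≤ N := Nat.cast_nonneg _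
    gcongr
    linarith
  linarith

/-- A function with Laplacian at most `d` away from a set `A` on which it is nonpositive has
total mass `O(N² / |A|)`. -/
theorem sum_le_of_laplacian_le (hG : G.IsEdgeExpander c d) {h : V → ℝ} {A : Finset V}
    (hA : A.Nonempty) (hA0 : ∀ v ∈ A, h v ≤ 0)
    (hsup : ∀ v, v ∉ A → ∑ w ∈ G.neighborFinset v, (h v - h w) ≤ d) :
    ∑ v, h v ≤ 9 * (Fintype.card V : ℝ) ^ 2 / (c ^ 2 * #A) := by
  have hc := hG.c_pos
  have hA1 : 0 < #A := hA.card_pos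
  have hA1' : (0 : ℝ) < #A := by exact_mod_cast hA1
  have hsub : A ⊆ ({v | h v ≤ 0} : Finset V) := fun v hv => by simpa using hA0 v hv
  have hsup' (v : V) (hv : 0 < h v) : ∑ w ∈ G.neighborFinset v, (h v - h w) ≤ d :=
    hsup v fun hvA => hv.not_ge (hA0 v hvA)
  have hcard := card_le_card hsub
  obtain ⟨t, ht0, ht, hhalf⟩ := hG.exists_level_half 0 hsup' (hA1.trans_le hcard)
  have hsum := hG.sum_le_of_level_half ht0 (fun v hv => hsup' v (ht0.trans_lt hv)) hhalf
  set N : ℝ := (Fintype.card V : ℝ) with hN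
  have hN0 : 0 ≤ N := Nat.cast_nonneg _
  have hcard' : (#A : ℝ) ≤ #({v | h v ≤ 0} : Finset V) := by exact_mod_cast hcard
  have hAN : (#A : ℝ) ≤ N := by rw [hN]; exact_mod_cast card_le_univ A
  have ht2 : t ≤ 6 * N / (c ^ 2 * #A) := by
    rw [zero_add] at ht
    refine ht.trans ?_
    gcongr
  have h1 : 3 * N / c ^ 2 ≤ 3 * N ^ 2 / (c ^ 2 * #A) := by
    rw [div_le_div_iff₀ (by positivity) (by positivity)]
    have : N * #A ≤ N ^ 2 := by nlinarith
    nlinarith [sq_nonneg c, mul_le_mul_of_nonneg_left this (sq_nonneg c)]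
  have h2 : N * t ≤ 6 * N ^ 2 / (c ^ 2 * #A) := by
    refine (mul_le_mul_of_nonneg_left ht2 hN0).trans (le_of_eq ?_)
    ring
  have h3 : 9 * N ^ 2 / (c ^ 2 * #A) = 6 * N ^ 2 / (c ^ 2 * #A) + 3 * N ^ 2 / (c ^ 2 * #A) := by
    ring
  linarith

end IsEdgeExpander

end

/-! ### Lazy random walks -/

section

variable {V : Type*} [Fintype V] {G : SimpleGraph V} [DecidableRel G.Adj]

/-- The averaging operator of the lazy random walk on `G` that crosses each edge at the current
vertex with probability `1 / d` and otherwise stays put. -/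
noncomputable def lazyStep (G : SimpleGraph V) [DecidableRel G.Adj] (d : ℕ) (f : V → ℝ) (v : V) :
    ℝ :=
  f v + (∑ w ∈ G.neighborFinset v, (f w - f v)) / d

theorem lazyStep_eq (d : ℕ) (f : V → ℝ) (v : V) :
    lazyStep G d f v = (1 - G.degree v / d) * f v + (∑ w ∈ G.neighborFinset v, f w) / d := by
  rw [lazyStep, sum_sub_distrib, sum_const, card_neighborFinset_eq_degree, nsmul_eq_mul]
  ring

theorem lazyStep_mono {d : ℕ} (hd0 : 0 < d) (hd : ∀ v, G.degree v ≤ d) {f g : V → ℝ}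
    (hfg : ∀ v, f v ≤ g v) (v : V) : lazyStep G d f v ≤ lazyStep G d g v := by
  rw [lazyStep_eq, lazyStep_eq]
  have hd0' : (0 : ℝ) < d := by exact_mod_cast hd0
  have h1 : 0 ≤ 1 - (G.degree v : ℝ) / d := by
    rw [sub_nonneg, div_le_one hd0']
    exact_mod_cast hd v
  have h2 := sum_le_sum fun w (_ : w ∈ G.neighborFinset v) => hfg w
  gcongr
  exact hfg v

theorem exists_le_lazyStep {d : ℕ} (hd0 : 0 < d) (hd : ∀ v, G.degree v ≤ d) (f : V → ℝ) (v : V) :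
    ∃ w, (v = w ∨ G.Adj v w) ∧ f w ≤ lazyStep G d f v := by
  by_contra! hcon
  have hd0' : (0 : ℝ) < d := by exact_mod_cast hd0
  have h1 := hcon v (Or.inl rfl)
  have h2 : ∑ w ∈ G.neighborFinset v, lazyStep G d f v ≤ ∑ w ∈ G.neighborFinset v, f w :=
    sum_le_sum fun w hw => (hcon w (Or.inr (by simpa using hw))).le
  rw [sum_const, card_neighborFinset_eq_degree, nsmul_eq_mul] at h2
  have h3 := lazyStep_eq (G := G) d f v
  set x := lazyStep G d f v
  have hdeg : (G.degree v : ℝ) ≤ d := by exact_mod_cast hd v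
  rcases hdeg.lt_or_eq with hlt | heq
  · have h4 : 0 < 1 - (G.degree v : ℝ) / d := by
      rw [sub_pos, div_lt_one hd0']; exact hlt
    have h5 : (G.degree v : ℝ) / d * x ≤ (∑ w ∈ G.neighborFinset v, f w) / d := by
      rw [div_mul_eq_mul_div]; gcongr
    nlinarith
  · have hne : (G.neighborFinset v).Nonempty := by
      rw [← card_pos, card_neighborFinset_eq_degree]
      have : G.degree v = d := by exact_mod_cast heq
      omega
    have h6 : ∑ w ∈ G.neighborFinset v, x < ∑ w ∈ G.neighborFinset v, f w :=
      sum_lt_sum_of_nonempty hne fun w hw => hcon w (Or.inr (by simpa using hw))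
    rw [sum_const, card_neighborFinset_eq_degree, nsmul_eq_mul, heq] at h6
    rw [heq, div_self hd0'.ne', sub_self, zero_mul, zero_add, eq_div_iff hd0'.ne'] at h3
    linarith

variable [DecidableEq V]

/-- The probability that the lazy random walk started at `v` avoids `A` up to time `t`, both ends
included. -/
noncomputable def avoidProb (G : SimpleGraph V) [DecidableRel G.Adj] (d : ℕ) (A : Finset V) :
    ℕ → V → ℝ
  | 0, v => if v ∈ A then 0 else 1
  | t + 1, v => if v ∈ A then 0 else lazyStep G d (avoidProb G d A t) v

theorem avoidProb_of_mem {d : ℕ} {A : Finset V} {v : V} (hv : v ∈ A) (t : ℕ) :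
    avoidProb G d A t v = 0 := by
  cases t <;> simp [avoidProb, hv]

theorem avoidProb_nonneg {d : ℕ} (hd0 : 0 < d) (hd : ∀ v, G.degree v ≤ d) (A : Finset V) (t : ℕ)
    (v : V) : 0 ≤ avoidProb G d A t v := by
  induction t generalizing v with
  | zero => simp only [avoidProb]; split_ifs <;> norm_num
  | succ t ih =>
    simp only [avoidProb]
    split_ifs
    · exact le_rfl
    · have := lazyStep_mono hd0 hd (f := fun _ => 0) ih v
      simpa [lazyStep] using this

theorem avoidProb_antitone {d : ℕ} (hd0 : 0 < d) (hd : ∀ v, G.degree v ≤ d) (A : Finset V)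
    (v : V) : Antitone fun t => avoidProb G d A t v := by
  refine antitone_nat_of_succ_le fun t => ?_
  induction t generalizing v with
  | zero =>
    by_cases hv : v ∈ A
    · rw [avoidProb_of_mem hv, avoidProb_of_mem hv]
    · have h0 : avoidProb G d A 0 v = 1 := by simp [avoidProb, hv]
      rw [h0, avoidProb, if_neg hv]
      refine (lazyStep_mono hd0 hd (f := avoidProb G d A 0) (g := fun _ => 1)
        (fun v => ?_) v).trans (by simp [lazyStep])
      simp only [avoidProb]
      split_ifs <;> norm_num
  | succ t ih =>
    by_cases hv : v ∈ A
    · rw [avoidProb_of_mem hv, avoidProb_of_mem hv]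
    · rw [avoidProb, if_neg hv]
      conv_rhs => rw [avoidProb, if_neg hv]
      exact lazyStep_mono hd0 hd ih v

theorem sum_avoidProb_le_card_compl {d : ℕ} (hd0 : 0 < d) (hd : ∀ v, G.degree v ≤ d)
    (A : Finset V) (t : ℕ) : ∑ v, avoidProb G d A t v ≤ (Fintype.card V : ℝ) - #A := by
  have h1 : ∑ v, avoidProb G d A t v ≤ ∑ v, avoidProb G d A 0 v :=
    sum_le_sum fun v _ => avoidProb_antitone hd0 hd A v (Nat.zero_le t)
  refine h1.trans (le_of_eq ?_)
  have h2 : ∑ v, avoidProb G d A 0 v = ∑ v, (1 - if v ∈ A then (1 : ℝ) else 0) :=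
    sum_congr rfl fun v _ => by simp only [avoidProb]; split_ifs <;> norm_num
  rw [h2, sum_sub_distrib]
  simp

/-- On an expander, the lazy walk from a uniformly random vertex avoids `A` for `t` steps with
probability `O(N / (t |A|))`. The truncated hitting time `∑ s < t, avoidProb A s` has Laplacian at
most `d` off `A`, because the sum telescopes; so its average is `O(N / |A|)`. -/
theorem IsEdgeExpander.sum_avoidProb_le {c : ℝ} {d : ℕ} (hG : G.IsEdgeExpander c d)
    {A : Finset V} (hA : A.Nonempty) {t : ℕ} (ht : 0 < t) :
    ∑ v, avoidProb G d A t v ≤ 9 * (Fintype.card V : ℝ) ^ 2 / (c ^ 2 * t * #A) := by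
  have hd0 : (0 : ℝ) < d := by exact_mod_cast hG.d_pos
  have hnn := avoidProb_nonneg hG.d_pos hG.degree_le A
  have hsum := hG.sum_le_of_laplacian_le (h := fun v => ∑ s ∈ range t, avoidProb G d A s v) hA
    (fun v hv => by simp [avoidProb_of_mem hv]) (by
      intro v hv
      have hstep (s : ℕ) : ∑ w ∈ G.neighborFinset v, (avoidProb G d A s v - avoidProb G d A s w) =
          d * (avoidProb G d A s v - avoidProb G d A (s + 1) v) := by
        conv_rhs => rw [avoidProb, if_neg hv, lazyStep]
        rw [sub_add_cancel_left, mul_neg, mul_div_cancel₀ _ hd0.ne', ← sum_neg_distrib]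
        simp
      simp only [← sum_sub_distrib]
      rw [sum_comm]
      simp only [hstep, ← mul_sum]
      rw [sum_range_sub' (fun s => avoidProb G d A s v)]
      have h0 : avoidProb G d A 0 v = 1 := by simp [avoidProb, hv]
      rw [h0]
      nlinarith [hnn t v])
  have ht' : (0 : ℝ) < t := by exact_mod_cast ht
  have hle : t * ∑ v, avoidProb G d A t v ≤ ∑ v, ∑ s ∈ range t, avoidProb G d A s v := by
    rw [mul_sum]
    refine sum_le_sum fun v _ => ?_
    have := card_nsmul_le_sum (range t) (fun s => avoidProb G d A s v) (avoidProb G d A t v)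
      fun s hs => avoidProb_antitone hG.d_pos hG.degree_le A v (mem_range.1 hs).le
    simpa using this
  have h2 := hle.trans hsum
  rw [mul_comm, ← le_div_iff₀ ht', div_div] at h2
  refine h2.trans (le_of_eq ?_)
  ring

theorem induce_singleton_connected {V : Type*} (G : SimpleGraph V) (v : V) :
    (G.induce {v}).Connected := by
  rw [induce_singleton_eq_top]
  exact connected_top

theorem induce_insert_connected {V : Type*} {G : SimpleGraph V} {s : Set V}
    (hs : (G.induce s).Connected) {v w : V} (hw : w ∈ s) (hvw : v = w ∨ G.Adj v w) :
    (G.induce (insert v s)).Connected := by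
  rcases hvw with rfl | hvw
  · rwa [Set.insert_eq_of_mem hw]
  · rw [Set.insert_eq]
    exact connected_induce_union (induce_singleton_connected G v).preconnected hs.preconnected
      rfl hw hvw

/-- Method of conditional expectations: some trajectory of the walk, here recorded as its vertex
set, misses at most the expected number of sets `A k`. -/
theorem exists_connected_card_missed_le {κ : Type*} {d : ℕ} (hd0 : 0 < d)
    (hd : ∀ v, G.degree v ≤ d) (A : κ → Finset V) (t : ℕ) (K : Finset κ) (v : V) :
    ∃ W : Finset V, v ∈ W ∧ (G.induce (W : Set V)).Connected ∧ #W ≤ t + 1 ∧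
      (#{k ∈ K | Disjoint W (A k)} : ℝ) ≤ ∑ k ∈ K, avoidProb G d (A k) t v := by
  induction t generalizing K v with
  | zero =>
    refine ⟨{v}, mem_singleton_self v, ?_, by simp, ?_⟩
    · rw [coe_singleton]; exact induce_singleton_connected G v
    · rw [card_filter]
      push_cast
      refine sum_le_sum fun k _ => ?_
      simp only [avoidProb, disjoint_singleton_left]
      split_ifs <;> simp_all
  | succ t ih =>
    set K' := {k ∈ K | v ∉ A k} with hK'
    obtain ⟨w, hvw, hw⟩ := exists_le_lazyStep hd0 hd
      (fun u => ∑ k ∈ K', avoidProb G d (A k) t u) v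
    obtain ⟨W, hwW, hWc, hWcard, hWm⟩ := ih K' w
    refine ⟨insert v W, mem_insert_self _ _, ?_, ?_, ?_⟩
    · rw [coe_insert]
      exact induce_insert_connected hWc hwW hvw
    · exact (card_insert_le _ _).trans (by omega)
    · have h1 : #{k ∈ K | Disjoint (insert v W) (A k)} ≤ #{k ∈ K' | Disjoint W (A k)} := by
        refine card_le_card fun k hk => ?_
        simp only [mem_filter, disjoint_insert_left, hK'] at hk ⊢
        tauto
      have h2 : lazyStep G d (fun u => ∑ k ∈ K', avoidProb G d (A k) t u) v =
          ∑ k ∈ K', lazyStep G d (avoidProb G d (A k) t) v := by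
        simp only [lazyStep, sum_add_distrib, ← sum_div, ← sum_sub_distrib]
        rw [sum_comm]
      have h3 : ∑ k ∈ K, avoidProb G d (A k) (t + 1) v =
          ∑ k ∈ K', lazyStep G d (avoidProb G d (A k) t) v := by
        rw [hK', sum_filter]
        refine sum_congr rfl fun k _ => ?_
        rw [avoidProb]
        split_ifs <;> simp_all
      rw [h3, ← h2]
      exact (Nat.cast_le.2 h1).trans (hWm.trans hw)

end

/-! ### Thickenings and connected sets meeting a family -/

section

variable {V : Type*} [Fintype V] [DecidableEq V] {G : SimpleGraph V} [DecidableRel G.Adj]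

/-- The set of vertices outside `S` with a neighbour in `S`. -/
def outerBoundary (G : SimpleGraph V) [DecidableRel G.Adj] (S : Finset V) : Finset V :=
  {v | v ∉ S ∧ ∃ u ∈ S, G.Adj u v}

/-- The set of vertices at distance at most `k` from `U`. -/
def thickening (G : SimpleGraph V) [DecidableRel G.Adj] (U : Finset V) : ℕ → Finset V
  | 0 => U
  | k + 1 => thickening G U k ∪ G.outerBoundary (thickening G U k)

theorem disjoint_outerBoundary (S : Finset V) : Disjoint S (G.outerBoundary S) := by
  rw [Finset.disjoint_left]
  intro v hv hv'
  simp only [outerBoundary, mem_filter, mem_univ, true_and] at hv'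
  exact hv'.1 hv

theorem card_thickening_succ (U : Finset V) (k : ℕ) :
    #(G.thickening U (k + 1)) = #(G.thickening U k) + #(G.outerBoundary (G.thickening U k)) := by
  rw [thickening, card_union_of_disjoint (disjoint_outerBoundary _)]

/-- A connected set within distance `k` of `U` can be joined to `U` by adding at most `k`
vertices. -/
theorem exists_connected_superset_not_disjoint {U W : Finset V} {k : ℕ}
    (hW : (G.induce (W : Set V)).Connected) (hWU : ¬ Disjoint W (G.thickening U k)) :
    ∃ W' : Finset V, W ⊆ W' ∧ (G.induce (W' : Set V)).Connected ∧ ¬ Disjoint W' U ∧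
      #W' ≤ #W + k := by
  induction k generalizing W with
  | zero => exact ⟨W, subset_rfl, hW, hWU, le_rfl⟩
  | succ k ih =>
    obtain ⟨v, hvW, hv⟩ := Finset.not_disjoint_iff.1 hWU
    rw [thickening, mem_union] at hv
    rcases hv with hv | hv
    · obtain ⟨W', h1, h2, h3, h4⟩ := ih hW (Finset.not_disjoint_iff.2 ⟨v, hvW, hv⟩)
      exact ⟨W', h1, h2, h3, by omega⟩
    · simp only [outerBoundary, mem_filter, mem_univ, true_and] at hv
      obtain ⟨-, u, hu, huv⟩ := hv
      obtain ⟨W', h1, h2, h3, h4⟩ := ih (W := insert u W)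
        (by rw [coe_insert]; exact induce_insert_connected hW (mem_coe.2 hvW) (Or.inr huv))
        (Finset.not_disjoint_iff.2 ⟨u, mem_insert_self _ _, hu⟩)
      refine ⟨W', (subset_insert _ _).trans h1, h2, h3, ?_⟩
      have := card_insert_le u W
      omega

namespace IsEdgeExpander

variable {c : ℝ} {d : ℕ}

theorem le_card_outerBoundary (hG : G.IsEdgeExpander c d) (S : Finset V) :
    c * min (#S : ℝ) (#Sᶜ : ℝ) ≤ #(G.outerBoundary S) := by
  have hd : (0 : ℝ) < d := by exact_mod_cast hG.d_pos
  have hsub : G.interedges S Sᶜ ⊆ G.interedges S (G.outerBoundary S) := by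
    intro p hp
    rw [mem_interedges_iff] at hp ⊢
    refine ⟨hp.1, ?_, hp.2.2⟩
    simp only [outerBoundary, mem_filter, mem_univ, true_and]
    exact ⟨mem_compl.1 hp.2.1, p.1, hp.1, hp.2.2⟩
  have h1 : (#(G.interedges S Sᶜ) : ℝ) ≤ #(G.outerBoundary S) * d := by
    exact_mod_cast (card_le_card hsub).trans (card_interedges_le_right hG.degree_le _ _)
  have h2 := (hG.le_card_interedges S).trans h1
  refine le_of_mul_le_mul_right ?_ hd
  linarith

theorem outerBoundary_nonempty (hG : G.IsEdgeExpander c d) {S : Finset V} (hS : S.Nonempty)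
    (hS' : S ≠ univ) : (G.outerBoundary S).Nonempty := by
  rw [← card_pos]
  have h1 : 0 < #S := hS.card_pos
  have h2 : 0 < #Sᶜ := by
    rw [card_pos, nonempty_iff_ne_empty, Ne, compl_eq_empty_iff]
    exact hS'
  have h3 : (0 : ℝ) < c * min (#S : ℝ) (#Sᶜ : ℝ) :=
    mul_pos hG.c_pos (lt_min (by exact_mod_cast h1) (by exact_mod_cast h2))
  exact_mod_cast h3.trans_le (hG.le_card_outerBoundary S)

theorem thickening_card_univ_eq (hG : G.IsEdgeExpander c d) {U : Finset V} (hU : U.Nonempty) :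
    G.thickening U (Fintype.card V) = univ := by
  have key (k : ℕ) : (G.thickening U k).Nonempty ∧
      min k (Fintype.card V) ≤ #(G.thickening U k) := by
    induction k with
    | zero => exact ⟨hU, by simp⟩
    | succ k ih =>
      refine ⟨ih.1.mono subset_union_left, ?_⟩
      rw [card_thickening_succ]
      by_cases h : G.thickening U k = univ
      · rw [h, card_univ]; omega
      · have := (hG.outerBoundary_nonempty ih.1 h).card_pos
        omega
  have := (key (Fintype.card V)).2
  rw [min_self] at this
  exact eq_univ_of_card _ (le_antisymm (card_le_univ _) this)

/-- Any connected set extends to one meeting every member of a family, at the cost of the sum of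
the distances; each distance is written as the number of thickenings that are missed. -/
theorem exists_connected_superset_meeting (hG : G.IsEdgeExpander c d) {W : Finset V}
    (hW : (G.induce (W : Set V)).Connected) (𝓤 : Finset (Finset V))
    (h𝓤 : ∀ U ∈ 𝓤, U.Nonempty) :
    ∃ W' : Finset V, W ⊆ W' ∧ (G.induce (W' : Set V)).Connected ∧
      (∀ U ∈ 𝓤, ¬ Disjoint W' U) ∧
      #W' ≤ #W + ∑ U ∈ 𝓤, #{k ∈ range (Fintype.card V) | Disjoint W (G.thickening U k)} := by
  induction 𝓤 using Finset.induction_on with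
  | empty => exact ⟨W, subset_rfl, hW, by simp, by simp⟩
  | insert U 𝓤 hU ih =>
    obtain ⟨W₁, h1, h2, h3, h4⟩ := ih fun U' hU' => h𝓤 U' (mem_insert_of_mem hU')
    set N := Fintype.card V with hN
    set m := #{k ∈ range N | Disjoint W (G.thickening U k)} with hm
    have hWne : W.Nonempty := by
      obtain ⟨x⟩ := hW.nonempty
      exact ⟨x.1, x.2⟩
    obtain ⟨k, hkm, hk⟩ : ∃ k ≤ m, ¬ Disjoint W (G.thickening U k) := by
      by_contra! hcon
      have hmN : m ≤ N := (card_filter_le _ _).trans (card_range N).le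
      rcases hmN.lt_or_eq with hlt | heq
      · have : range (m + 1) ⊆ {k ∈ range N | Disjoint W (G.thickening U k)} := by
          intro k hk
          rw [mem_range] at hk
          rw [mem_filter, mem_range]
          exact ⟨by omega, hcon k (by omega)⟩
        have := card_le_card this
        rw [card_range] at this
        omega
      · have := hcon N heq.ge
        rw [hN, hG.thickening_card_univ_eq (h𝓤 U (mem_insert_self _ _))] at this
        obtain ⟨x, hx⟩ := hWne
        exact Finset.disjoint_left.1 this hx (mem_univ x)
    have hk' : ¬ Disjoint W₁ (G.thickening U k) := fun h => hk (h.mono_left h1)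
    obtain ⟨W₂, h5, h6, h7, h8⟩ := exists_connected_superset_not_disjoint h2 hk'
    refine ⟨W₂, h1.trans h5, h6, ?_, ?_⟩
    · intro U' hU'
      rcases mem_insert.1 hU' with rfl | hU'
      · exact h7
      · exact fun h => h3 U' hU' (h.mono_left h5)
    · rw [sum_insert hU]
      omega

/-- The expected distance from the lazy walk to `U`, summed over all starting vertices. The bound
is `O(N)` uniformly because the probabilities of missing the thickenings of `U` are dominated by a
telescoping sum: `1 / b` decreases by a constant factor while the size `b` of the thickening is
below `N / 2`, and afterwards `N - b` does. -/
theorem sum_sum_avoidProb_thickening_le (hG : G.IsEdgeExpander c d) {s : ℕ} (hs : 0 < s)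
    (hN : Fintype.card V ≤ s ^ 2) {U : Finset V} (hU : c * s ≤ #U) (L : ℕ) :
    ∑ k ∈ range L, ∑ v, avoidProb G d (G.thickening U k) s v ≤
      19 / c ^ 4 * Fintype.card V := by
  have hc := hG.c_pos
  have hc1 := hG.c_le_one
  have hs' : (0 : ℝ) < s := by exact_mod_cast hs
  set N : ℝ := (Fintype.card V : ℝ) with hNdef
  have hN' : N ≤ (s : ℝ) ^ 2 := by rw [hNdef]; exact_mod_cast hN
  have hN0 : 0 ≤ N := Nat.cast_nonneg _
  set b : ℕ → ℝ := fun k => #(G.thickening U k) with hb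
  have hb0 : c * s ≤ b 0 := hU
  have hmono (k : ℕ) : b k ≤ b (k + 1) := by
    simp only [hb, card_thickening_succ]
    push_cast
    linarith [(Nat.cast_nonneg _ : (0 : ℝ) ≤ #(G.outerBoundary (G.thickening U k)))]
  have hbpos (k : ℕ) : 0 < b k :=
    (mul_pos hc hs').trans_le (hb0.trans (monotone_nat_of_le_succ hmono (Nat.zero_le k)))
  have hbN (k : ℕ) : b k ≤ N := by
    simp only [hb, hNdef]
    exact_mod_cast card_le_univ _
  have hgrow (k : ℕ) : c * min (b k) (N - b k) ≤ b (k + 1) - b k := by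
    have h1 := hG.le_card_outerBoundary (G.thickening U k)
    have h2 : (#(G.thickening U k)ᶜ : ℝ) = N - b k := by
      rw [eq_sub_iff_add_eq', hNdef]
      simp only [hb]
      exact_mod_cast card_add_card_compl (G.thickening U k)
    rw [h2] at h1
    have h3 : b (k + 1) - b k = #(G.outerBoundary (G.thickening U k)) := by
      simp only [hb, card_thickening_succ]
      push_cast
      ring
    rw [h3]
    exact h1
  set α : ℝ := 18 * N ^ 2 / (c ^ 3 * s) with hα
  have hα0 : 0 ≤ α := by positivity
  have hterm (k : ℕ) : ∑ v, avoidProb G d (G.thickening U k) s v ≤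
      α * (1 / b k - 1 / b (k + 1)) + 1 / c * (b (k + 1) - b k) := by
    have hinv : 1 / b (k + 1) ≤ 1 / b k := one_div_le_one_div_of_le (hbpos k) (hmono k)
    have hk0 := hbpos k
    have hne : (G.thickening U k).Nonempty := by
      rw [← card_pos]
      simp only [hb] at hk0
      exact_mod_cast hk0
    by_cases hhalf : b k ≤ N - b k
    · have h1 := hG.sum_avoidProb_le hne hs
      have h2 := hgrow k
      rw [min_eq_left hhalf] at h2
      have h3 : 1 / b (k + 1) ≤ 1 / ((1 + c) * b k) :=
        one_div_le_one_div_of_le (by positivity) (by linarith)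
      have h4 : c / (2 * b k) ≤ 1 / b k - 1 / ((1 + c) * b k) := by
        have : 1 / b k - 1 / ((1 + c) * b k) = c / ((1 + c) * b k) := by field_simp; ring
        rw [this]
        gcongr
        linarith
      have h5 : 9 * N ^ 2 / (c ^ 2 * s * b k) = α * (c / (2 * b k)) := by
        rw [hα]; field_simp; ring
      have h6 : α * (c / (2 * b k)) ≤ α * (1 / b k - 1 / b (k + 1)) := by
        gcongr; linarith
      have h7 : 0 ≤ 1 / c * (b (k + 1) - b k) := by
        have := hmono k
        have : 0 ≤ b (k + 1) - b k := by linarith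
        positivity
      have h8 : ∑ v, avoidProb G d (G.thickening U k) s v ≤ 9 * N ^ 2 / (c ^ 2 * s * b k) := h1
      linarith
    · have h1 := sum_avoidProb_le_card_compl hG.d_pos hG.degree_le (G.thickening U k) s
      have h2 := hgrow k
      rw [min_eq_right (not_le.1 hhalf).le] at h2
      have h3 : N - b k ≤ 1 / c * (b (k + 1) - b k) := by
        rw [one_div_mul_eq_div, le_div_iff₀ hc]
        linarith
      have h4 : 0 ≤ α * (1 / b k - 1 / b (k + 1)) := mul_nonneg hα0 (by linarith)
      have h5 : ∑ v, avoidProb G d (G.thickening U k) s v ≤ N - b k := h1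
      linarith
  refine (sum_le_sum fun k _ => hterm k).trans ?_
  rw [sum_add_distrib, ← mul_sum, ← mul_sum, sum_range_sub' (fun k => 1 / b k), sum_range_sub]
  have h1 : α * (1 / b 0 - 1 / b L) ≤ 18 / c ^ 4 * N := by
    have h2 : 1 / b 0 - 1 / b L ≤ 1 / (c * s) := by
      have := one_div_le_one_div_of_le (mul_pos hc hs') hb0
      have := one_div_pos.2 (hbpos L)
      linarith
    have h3 : α * (1 / (c * s)) = 18 / c ^ 4 * N * (N / s ^ 2) := by
      rw [hα]; field_simp
    have h4 : N / (s : ℝ) ^ 2 ≤ 1 := by rwa [div_le_one (by positivity)]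
    calc α * (1 / b 0 - 1 / b L) ≤ α * (1 / (c * s)) := by gcongr
      _ = 18 / c ^ 4 * N * (N / s ^ 2) := h3
      _ ≤ 18 / c ^ 4 * N * 1 := by gcongr
      _ = _ := mul_one _
  have h2 : 1 / c * (b L - b 0) ≤ 1 / c ^ 4 * N := by
    have h3 : 1 / c ≤ 1 / c ^ 4 := by
      apply one_div_le_one_div_of_le (by positivity)
      exact pow_le_of_le_one hc.le hc1 (by norm_num)
    have h4 : b L - b 0 ≤ N := by linarith [hbN L, hbpos 0]
    have h5 : 0 ≤ b L - b 0 := by linarith [monotone_nat_of_le_succ hmono (Nat.zero_le L)]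
    gcongr
  have h3 : 19 / c ^ 4 * N = 18 / c ^ 4 * N + 1 / c ^ 4 * N := by ring
  linarith

theorem exists_connected_superset_card_ge (hG : G.IsEdgeExpander c d) {W : Finset V}
    (hW : (G.induce (W : Set V)).Connected) {s : ℕ} (hs : s ≤ Fintype.card V) :
    ∃ W' : Finset V, W ⊆ W' ∧ (G.induce (W' : Set V)).Connected ∧ s ≤ #W' ∧ #W' ≤ max s #W := by
  induction s with
  | zero => exact ⟨W, subset_rfl, hW, Nat.zero_le _, le_max_right _ _⟩
  | succ s ih =>
    obtain ⟨W', h1, h2, h3, h4⟩ := ih (by omega)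
    by_cases h : s + 1 ≤ #W'
    · exact ⟨W', h1, h2, h, h4.trans (max_le_max_right _ (Nat.le_succ s))⟩
    · have hne : W' ≠ univ := by
        rintro rfl
        rw [card_univ] at h
        omega
      obtain ⟨x⟩ := h2.nonempty
      obtain ⟨v, hv⟩ := hG.outerBoundary_nonempty ⟨x.1, x.2⟩ hne
      simp only [outerBoundary, mem_filter, mem_univ, true_and] at hv
      obtain ⟨hvW, u, hu, huv⟩ := hv
      refine ⟨insert v W', h1.trans (subset_insert _ _), ?_, ?_, ?_⟩
      · rw [coe_insert]
        exact induce_insert_connected h2 (mem_coe.2 hu) (Or.inr huv.symm)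
      all_goals
        rw [card_insert_of_notMem hvW]
        omega

/-- In an expander on at most `s²` vertices, `s` sets of size `Ω(s)` can all be met by one
connected set of size `O(s)`. -/
theorem exists_connected_meeting (hG : G.IsEdgeExpander c d) {s : ℕ} (hs : 0 < s)
    (hN : Fintype.card V ≤ s ^ 2) (hsN : s ≤ Fintype.card V) (𝓤 : Finset (Finset V))
    (hcard : #𝓤 ≤ s) (h𝓤 : ∀ U ∈ 𝓤, c * s ≤ #U) :
    ∃ B : Finset V, (G.induce (B : Set V)).Connected ∧ (∀ U ∈ 𝓤, ¬ Disjoint B U) ∧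
      s ≤ #B ∧ (#B : ℝ) ≤ 21 / c ^ 4 * s := by
  have hc := hG.c_pos
  have hc1 := hG.c_le_one
  have hs' : (0 : ℝ) < s := by exact_mod_cast hs
  set N := Fintype.card V with hNdef
  have hN0 : (0 : ℝ) < N := by exact_mod_cast hs.trans_le hsN
  have hne : (univ : Finset V).Nonempty := by
    rw [← card_pos, card_univ]; omega
  set K := 𝓤 ×ˢ range N with hK
  set A : Finset V × ℕ → Finset V := fun p => G.thickening p.1 p.2 with hA
  have htotal : ∑ v, ∑ k ∈ K, avoidProb G d (A k) s v ≤
      ∑ v : V, (s : ℝ) * (19 / c ^ 4) := by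
    rw [sum_comm, hK, sum_product, sum_const, card_univ, nsmul_eq_mul]
    have := sum_le_card_nsmul 𝓤 (fun U => ∑ k ∈ range N, ∑ v, avoidProb G d (A (U, k)) s v)
      (19 / c ^ 4 * N) fun U hU => hG.sum_sum_avoidProb_thickening_le hs hN (h𝓤 U hU) N
    refine this.trans ?_
    rw [nsmul_eq_mul]
    have h1 : (#𝓤 : ℝ) ≤ s := by exact_mod_cast hcard
    calc (#𝓤 : ℝ) * (19 / c ^ 4 * N) ≤ s * (19 / c ^ 4 * N) := by gcongr
      _ = _ := by ring
  obtain ⟨v, -, hv⟩ := exists_le_of_sum_le hne htotal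
  obtain ⟨W, -, hWc, hWs, hWm⟩ := exists_connected_card_missed_le hG.d_pos hG.degree_le A s K v
  have hU0 : ∀ U ∈ 𝓤, U.Nonempty := fun U hU => by
    rw [← card_pos]
    exact_mod_cast (mul_pos hc hs').trans_le (h𝓤 U hU)
  obtain ⟨W₁, h1, h2, h3, h4⟩ := hG.exists_connected_superset_meeting hWc 𝓤 hU0
  obtain ⟨B, h5, h6, h7, h8⟩ := hG.exists_connected_superset_card_ge h2 hsN
  refine ⟨B, h6, fun U hU h => h3 U hU (h.mono_left h5), h7, ?_⟩
  have hmiss : ∑ U ∈ 𝓤, #{k ∈ range N | Disjoint W (G.thickening U k)} =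
      #{k ∈ K | Disjoint W (A k)} := by
    simp only [card_filter, hK, hA]
    rw [sum_product]
  rw [← hNdef, hmiss] at h4
  have h4' : (#W₁ : ℝ) ≤ #W + #{k ∈ K | Disjoint W (A k)} := by exact_mod_cast h4
  have hWs' : (#W : ℝ) ≤ s + 1 := by exact_mod_cast hWs
  have h8' : (#B : ℝ) ≤ max (s : ℝ) (#W₁ : ℝ) := by exact_mod_cast h8
  have hone : 1 ≤ 1 / c ^ 4 := by
    rw [le_div_iff₀ (by positivity), one_mul]
    exact pow_le_one₀ hc.le hc1
  have hs1 : (1 : ℝ) ≤ s := by exact_mod_cast hs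
  have h9 : (21 / c ^ 4 * s : ℝ) = 2 * (1 / c ^ 4 * s) + s * (19 / c ^ 4) := by ring
  have h10 : (s : ℝ) ≤ 1 / c ^ 4 * s := by nlinarith
  have h11 : 0 ≤ (s : ℝ) * (19 / c ^ 4) := by positivity
  refine h8'.trans (max_le ?_ ?_) <;> rw [h9] <;> linarith

end IsEdgeExpander

end

/-! ### Growing a clique minor -/

section

variable {V : Type*} [Fintype V] [DecidableEq V] {G : SimpleGraph V} [DecidableRel G.Adj]

theorem le_ccl_of_finset_family {V : Type*} [Finite V] {G : SimpleGraph V} (𝓑 : Finset (Finset V))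
    (hconn : ∀ B ∈ 𝓑, (G.induce (B : Set V)).Connected)
    (hdisj : ∀ B ∈ 𝓑, ∀ B' ∈ 𝓑, B ≠ B' → Disjoint B B')
    (hadj : ∀ B ∈ 𝓑, ∀ B' ∈ 𝓑, B ≠ B' → ∃ x ∈ B, ∃ y ∈ B', G.Adj x y) :
    #𝓑 ≤ G.ccl := by
  refine (isGreatest_ccl G).2 ⟨fun i => ((𝓑.equivFin.symm i : Finset V) : Set V),
    fun i => hconn _ (𝓑.equivFin.symm i).2, fun i j hij => ?_, fun i j hij => ?_⟩
  · rw [disjoint_coe]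
    exact hdisj _ (𝓑.equivFin.symm i).2 _ (𝓑.equivFin.symm j).2
      fun h => hij (𝓑.equivFin.symm.injective (Subtype.ext h))
  · exact hadj _ (𝓑.equivFin.symm i).2 _ (𝓑.equivFin.symm j).2
      fun h => hij.ne (𝓑.equivFin.symm.injective (Subtype.ext h))

theorem isEdgeExpander_of_half {c : ℝ} {d : ℕ} (hc : 0 < c) (hc1 : c ≤ 1) (hd0 : 0 < d)
    (hd : ∀ v, G.degree v ≤ d)
    (hexp : ∀ S : Finset V, 2 * #S ≤ Fintype.card V → c * d * #S ≤ #(G.interedges S Sᶜ)) :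
    G.IsEdgeExpander c d := by
  refine ⟨hc, hc1, hd0, hd, fun S => ?_⟩
  have hcard := card_add_card_compl S
  have hcd : 0 ≤ c * d := by positivity
  by_cases h : 2 * #S ≤ Fintype.card V
  · exact (mul_le_mul_of_nonneg_left (min_le_left _ _) hcd).trans (hexp S h)
  · have := hexp Sᶜ (by omega)
    rw [compl_compl, card_interedges_symm] at this
    exact (mul_le_mul_of_nonneg_left (min_le_right _ _) hcd).trans this

/-- Expansion of an induced subgraph, expressed inside the ambient graph. -/
theorem isEdgeExpander_induce {c : ℝ} {d : ℕ} (hc : 0 < c) (hc1 : c ≤ 1) (hd0 : 0 < d)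
    (hd : ∀ v, G.degree v ≤ d) (U : Finset V)
    (hexp : ∀ S ⊆ U, 2 * #S ≤ #U → c * d * #S ≤ #(G.interedges S (U \ S))) :
    (G.induce (U : Set V)).IsEdgeExpander c d := by
  refine isEdgeExpander_of_half hc hc1 hd0 (fun v => ?_) fun S hS => ?_
  · refine le_trans ?_ (hd v)
    rw [← card_neighborFinset_eq_degree, ← card_neighborFinset_eq_degree]
    refine card_le_card_of_injOn Subtype.val (fun w hw => ?_) Subtype.val_injective.injOn
    simpa using hw
  · set S' : Finset V := S.map (Function.Embedding.subtype _) with hS'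
    have hcard : #S' = #S := card_map _
    have hSU : S' ⊆ U := by
      intro v hv
      simp only [hS', mem_map, Function.Embedding.subtype_apply] at hv
      obtain ⟨w, -, rfl⟩ := hv
      exact w.2
    have h1 := hexp S' hSU (by simpa [hcard] using hS)
    rw [hcard] at h1
    refine h1.trans (Nat.cast_le.2 ?_)
    have hsub : G.interedges S' (U \ S') ⊆
        ((G.induce (U : Set V)).interedges S Sᶜ).image (Prod.map Subtype.val Subtype.val) := by
      rintro ⟨x, y⟩ hp
      rw [mk_mem_interedges_iff, mem_sdiff] at hp
      obtain ⟨hx, ⟨hyU, hyS⟩, hxy⟩ := hp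
      simp only [hS', mem_map, Function.Embedding.subtype_apply] at hx hyS
      obtain ⟨x', hx', rfl⟩ := hx
      refine mem_image.2 ⟨(x', ⟨y, hyU⟩), ?_, rfl⟩
      rw [mk_mem_interedges_iff, mem_compl]
      exact ⟨hx', fun h => hyS ⟨_, h, rfl⟩, hxy⟩
    exact (card_le_card hsub).trans card_image_le

theorem induce_map_subtype_connected {V : Type*} {G : SimpleGraph V} {U : Set V} {B : Finset U}
    (hB : ((G.induce U).induce (B : Set U)).Connected) :
    (G.induce ((B.map (Function.Embedding.subtype _) : Finset V) : Set V)).Connected := by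
  let f : (G.induce U).induce (B : Set U) →g
      G.induce ((B.map (Function.Embedding.subtype _) : Finset V) : Set V) :=
    ⟨fun x => ⟨x.1.1, mem_coe.2 (mem_map_of_mem _ x.2)⟩, fun h => h⟩
  refine hB.map f ?_
  rintro ⟨v, hv⟩
  obtain ⟨w, hw, rfl⟩ := mem_map.1 (mem_coe.1 hv)
  exact ⟨⟨w, hw⟩, rfl⟩

/-- A partial clique minor in `G`: branch sets `𝓑` of sizes between `s` and `m`, and a set `D` of
discarded vertices, disjoint from them, which sends few edges to the remaining vertices. -/
structure IsPartialMinor (G : SimpleGraph V) [DecidableRel G.Adj] (c : ℝ) (d s r : ℕ) (m : ℝ)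
    (D : Finset V) (𝓑 : Finset (Finset V)) : Prop where
  connected : ∀ B ∈ 𝓑, (G.induce (B : Set V)).Connected
  disjoint : ∀ B ∈ 𝓑, ∀ B' ∈ 𝓑, B ≠ B' → Disjoint B B'
  adj : ∀ B ∈ 𝓑, ∀ B' ∈ 𝓑, B ≠ B' → ∃ x ∈ B, ∃ y ∈ B', G.Adj x y
  le_card : ∀ B ∈ 𝓑, s ≤ #B
  card_le : ∀ B ∈ 𝓑, (#B : ℝ) ≤ m
  card_family_le : #𝓑 ≤ r
  disjoint_discarded : ∀ B ∈ 𝓑, Disjoint B D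
  card_interedges_le : (#(G.interedges D (D ∪ 𝓑.biUnion id)ᶜ) : ℝ) ≤ c * d * #D
  card_discarded_le : 3 * #D ≤ 2 * Fintype.card V

namespace IsPartialMinor

variable {c ε m : ℝ} {d s r : ℕ} {D : Finset V} {𝓑 : Finset (Finset V)}

theorem card_biUnion_le (h : G.IsPartialMinor c d s r m D 𝓑) (hm : 0 ≤ m) :
    (#(𝓑.biUnion id) : ℝ) ≤ r * m := by
  have h1 : (#(𝓑.biUnion id) : ℝ) ≤ ∑ B ∈ 𝓑, (#B : ℝ) := by
    exact_mod_cast Finset.card_biUnion_le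
  have h2 := sum_le_card_nsmul 𝓑 (fun B => (#B : ℝ)) m h.card_le
  rw [nsmul_eq_mul] at h2
  have h3 : (#𝓑 : ℝ) ≤ r := by exact_mod_cast h.card_family_le
  exact h1.trans (h2.trans (by gcongr))

/-- The discarded set sends few edges both to the remaining vertices and to the branch sets, so by
expansion it is small. -/
theorem four_mul_card_discarded_le (h : G.IsPartialMinor (ε / 8) d s r m D 𝓑)
    (hG : G.IsEdgeExpander ε d) (hm : 0 ≤ m) (hrm : r * m ≤ ε / 12 * Fintype.card V) :
    4 * #D ≤ Fintype.card V := by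
  by_contra! hcon
  set n := Fintype.card V with hn
  have hε := hG.c_pos
  have hd : (0 : ℝ) < d := by exact_mod_cast hG.d_pos
  set C := 𝓑.biUnion id with hC
  have hcard := card_add_card_compl D
  have hD := h.card_discarded_le
  have hD1 : (3 * #D : ℝ) ≤ 2 * n := by exact_mod_cast hD
  have hD2 : (n : ℝ) < 4 * #D := by exact_mod_cast hcon
  have hD3 : (#D : ℝ) + #Dᶜ = n := by exact_mod_cast hcard
  have hn0 : (0 : ℝ) < n := by
    have : 0 < n := by
      rw [← hn] at hcard
      omega
    exact_mod_cast this
  have hDC : Disjoint C D := by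
    rw [hC, disjoint_biUnion_left]
    exact h.disjoint_discarded
  have hcompl : Dᶜ = (D ∪ C)ᶜ ∪ C := by
    ext v
    have : v ∈ C → v ∉ D := fun hv => Finset.disjoint_left.1 hDC hv
    simp only [mem_compl, mem_union]
    tauto
  have hdis : Disjoint (D ∪ C)ᶜ C :=
    (disjoint_compl_left (a := D ∪ C)).mono_right subset_union_right
  have hsplit := card_interedges_union_right (G := G) D hdis
  rw [← hcompl] at hsplit
  have hsplit' : (#(G.interedges D Dᶜ) : ℝ) =
      #(G.interedges D (D ∪ C)ᶜ) + #(G.interedges D C) := by exact_mod_cast hsplit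
  have h1 : (#(G.interedges D C) : ℝ) ≤ #C * d := by
    exact_mod_cast card_interedges_le_right hG.degree_le D C
  have h2 := h.card_biUnion_le hm
  have h3 := hG.le_card_interedges D
  have h4 := h.card_interedges_le
  have h5 : ε * d * (n / 4) ≤ ε * d * min (#D : ℝ) (#Dᶜ : ℝ) := by
    gcongr
    exact le_min (by linarith) (by linarith)
  have h6 : (#C : ℝ) * d ≤ ε / 12 * n * d := by gcongr; linarith
  have h7 : ε / 8 * d * #D ≤ ε / 8 * d * (2 / 3 * n) := by gcongr; linarith
  have h8 : 0 < ε * d * n := by positivity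
  linarith

/-- Remaining vertices with few edges to the other remaining ones can be discarded. -/
theorem discard_subset (h : G.IsPartialMinor c d s r m D 𝓑) (hD : 4 * #D ≤ Fintype.card V)
    {S : Finset V} (hSU : S ⊆ (D ∪ 𝓑.biUnion id)ᶜ) (hS2 : 2 * #S ≤ #(D ∪ 𝓑.biUnion id)ᶜ)
    (hS : (#(G.interedges S ((D ∪ 𝓑.biUnion id)ᶜ \ S)) : ℝ) < c * d * #S) :
    G.IsPartialMinor c d s r m (D ∪ S) 𝓑 := by
  set C := 𝓑.biUnion id with hC
  have hSdis : Disjoint (D ∪ C) S :=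
    (disjoint_compl_right (a := D ∪ C)).mono_right hSU
  have hDS : Disjoint D S := hSdis.mono_left subset_union_left
  have hcard : #(D ∪ S) = #D + #S := card_union_of_disjoint hDS
  refine ⟨h.connected, h.disjoint, h.adj, h.le_card, h.card_le, h.card_family_le,
    fun B hB => ?_, ?_, ?_⟩
  · rw [disjoint_union_right]
    refine ⟨h.disjoint_discarded B hB, hSdis.mono_left ?_⟩
    exact (subset_biUnion_of_mem id hB).trans subset_union_right
  · have hU : (D ∪ S ∪ C)ᶜ = (D ∪ C)ᶜ \ S := by
      ext v
      simp only [mem_compl, mem_union, mem_sdiff]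
      tauto
    rw [hU, card_interedges_union_left hDS, hcard]
    have h1 : #(G.interedges D ((D ∪ C)ᶜ \ S)) ≤ #(G.interedges D (D ∪ C)ᶜ) :=
      card_le_card (G.interedges_mono subset_rfl sdiff_subset)
    have h2 : (#(G.interedges D ((D ∪ C)ᶜ \ S)) : ℝ) ≤ #(G.interedges D (D ∪ C)ᶜ) := by
      exact_mod_cast h1
    have h3 := h.card_interedges_le
    push_cast
    linarith
  · have h1 : #(D ∪ C)ᶜ ≤ #Dᶜ := card_le_card (compl_subset_compl.2 subset_union_left)
    have h2 := card_add_card_compl D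
    omega

/-- A branch set with few edges to the remaining vertices can be discarded. -/
theorem discard_branch (h : G.IsPartialMinor c d s r m D 𝓑) (hD : 4 * #D ≤ Fintype.card V)
    {B : Finset V} (hB : B ∈ 𝓑) (hB12 : 12 * #B ≤ Fintype.card V)
    (hB' : (#(G.interedges B (D ∪ 𝓑.biUnion id)ᶜ) : ℝ) < c * d * #B) :
    G.IsPartialMinor c d s r m (D ∪ B) (𝓑.erase B) := by
  have hmem : ∀ {B'}, B' ∈ 𝓑.erase B → B' ∈ 𝓑 := fun hB' => mem_of_mem_erase hB'
  have hDB : Disjoint D B := (h.disjoint_discarded B hB).symm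
  have hcard : #(D ∪ B) = #D + #B := card_union_of_disjoint hDB
  refine ⟨fun B' h' => h.connected B' (hmem h'),
    fun B' h' B'' h'' => h.disjoint B' (hmem h') B'' (hmem h''),
    fun B' h' B'' h'' => h.adj B' (hmem h') B'' (hmem h''),
    fun B' h' => h.le_card B' (hmem h'), fun B' h' => h.card_le B' (hmem h'),
    (card_le_card (erase_subset _ _)).trans h.card_family_le, fun B' h' => ?_, ?_, ?_⟩
  · rw [disjoint_union_right]
    exact ⟨h.disjoint_discarded B' (hmem h'),
      h.disjoint B' (hmem h') B hB (ne_of_mem_erase h')⟩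
  · have hU : D ∪ B ∪ (𝓑.erase B).biUnion id = D ∪ 𝓑.biUnion id := by
      conv_rhs => rw [← insert_erase hB, biUnion_insert]
      rw [union_assoc, id]
    rw [hU, card_interedges_union_left hDB, hcard]
    have h3 := h.card_interedges_le
    push_cast
    linarith
  · omega

/-- A new branch set can be added inside an expanding remainder if every old branch set has many
edges to the remainder. -/
theorem exists_add_branch (h : G.IsPartialMinor c d s r (21 / c ^ 4 * s) D 𝓑)
    (hc : 0 < c) (hd0 : 0 < d) (hd : ∀ v, G.degree v ≤ d) (hs : 0 < s)
    (hn : Fintype.card V ≤ s ^ 2) (hrs : r ≤ s) (hr : #𝓑 < r)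
    (hU : (G.induce (((D ∪ 𝓑.biUnion id)ᶜ : Finset V) : Set V)).IsEdgeExpander c d)
    (hsU : s ≤ #(D ∪ 𝓑.biUnion id)ᶜ)
    (hB : ∀ B ∈ 𝓑, c * d * #B ≤ #(G.interedges B (D ∪ 𝓑.biUnion id)ᶜ)) :
    ∃ B ∉ 𝓑, G.IsPartialMinor c d s r (21 / c ^ 4 * s) D (insert B 𝓑) := by
  set C := 𝓑.biUnion id with hC
  set U := (D ∪ C)ᶜ with hUdef
  have hd0' : (0 : ℝ) < d := by exact_mod_cast hd0
  have hcardU : Fintype.card ((U : Finset V) : Set V) = #U := by simp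
  -- The sets to be met are the neighbourhoods of the old branch sets in the remainder.
  set nb : Finset V → Finset ((U : Finset V) : Set V) :=
    fun B => {u | ∃ b ∈ B, G.Adj b u} with hnb
  have hnbcard (B : Finset V) (hBm : B ∈ 𝓑) : c * s ≤ #(nb B) := by
    set N' := (nb B).map (Function.Embedding.subtype _) with hN'
    have h1 : G.interedges B U ⊆ G.interedges B N' := by
      rintro ⟨x, y⟩ hp
      rw [mk_mem_interedges_iff] at hp ⊢
      refine ⟨hp.1, mem_map.2 ⟨⟨y, hp.2.1⟩, ?_, rfl⟩, hp.2.2⟩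
      simp only [hnb, mem_filter, mem_univ, true_and]
      exact ⟨x, hp.1, hp.2.2⟩
    have h2 : (#(G.interedges B U) : ℝ) ≤ #(nb B) * d := by
      have := (card_le_card h1).trans (card_interedges_le_right hd B N')
      rw [hN', card_map] at this
      exact_mod_cast this
    have h3 := (hB B hBm).trans h2
    have h4 : (s : ℝ) ≤ #B := by exact_mod_cast h.le_card B hBm
    have h5 : c * d * s ≤ c * d * #B := by gcongr
    refine le_of_mul_le_mul_right ?_ hd0'
    linarith
  obtain ⟨B₀, hconn, hmeet, hge, hle⟩ := hU.exists_connected_meeting hs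
    (by rw [hcardU]; exact (card_le_univ U).trans hn) (by rw [hcardU]; exact hsU)
    (𝓑.image nb) (card_image_le.trans (hr.le.trans hrs))
    (fun N hN => by
      obtain ⟨B, hBm, rfl⟩ := mem_image.1 hN
      exact hnbcard B hBm)
  set B := B₀.map (Function.Embedding.subtype _) with hBdef
  have hBcard : #B = #B₀ := card_map _
  have hBU : B ⊆ U := by
    intro v hv
    obtain ⟨w, -, rfl⟩ := mem_map.1 hv
    exact w.2
  have hBdis : Disjoint B (D ∪ C) :=
    (disjoint_compl_left (a := D ∪ C)).mono_left hBU
  have hBdis' (B' : Finset V) (hB' : B' ∈ 𝓑) : Disjoint B B' :=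
    hBdis.mono_right ((subset_biUnion_of_mem id hB').trans subset_union_right)
  have hBadj (B' : Finset V) (hB' : B' ∈ 𝓑) : ∃ x ∈ B, ∃ y ∈ B', G.Adj x y := by
    obtain ⟨u, hu, hu'⟩ := Finset.not_disjoint_iff.1 (hmeet _ (mem_image_of_mem nb hB'))
    simp only [hnb, mem_filter, mem_univ, true_and] at hu'
    obtain ⟨b, hb, hbu⟩ := hu'
    exact ⟨u, mem_map_of_mem _ hu, b, hb, hbu.symm⟩
  have hBnot : B ∉ 𝓑 := by
    intro hmem
    have := hBdis' B hmem
    rw [_root_.disjoint_self, bot_eq_empty, ← card_eq_zero] at this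
    omega
  refine ⟨B, hBnot, ?_, ?_, ?_, ?_, ?_, ?_, ?_, ?_, h.card_discarded_le⟩
  · intro B' hB'
    rcases mem_insert.1 hB' with rfl | hB'
    · exact induce_map_subtype_connected hconn
    · exact h.connected B' hB'
  · intro B₁ h₁ B₂ h₂ hne
    rcases mem_insert.1 h₁ with rfl | h₁ <;> rcases mem_insert.1 h₂ with rfl | h₂
    · exact absurd rfl hne
    · exact hBdis' _ h₂
    · exact (hBdis' _ h₁).symm
    · exact h.disjoint _ h₁ _ h₂ hne
  · intro B₁ h₁ B₂ h₂ hne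
    rcases mem_insert.1 h₁ with rfl | h₁ <;> rcases mem_insert.1 h₂ with rfl | h₂
    · exact absurd rfl hne
    · exact hBadj _ h₂
    · obtain ⟨x, hx, y, hy, hxy⟩ := hBadj _ h₁
      exact ⟨y, hy, x, hx, hxy.symm⟩
    · exact h.adj _ h₁ _ h₂ hne
  · intro B' hB'
    rcases mem_insert.1 hB' with rfl | hB'
    · rw [hBcard]; exact hge
    · exact h.le_card B' hB'
  · intro B' hB'
    rcases mem_insert.1 hB' with rfl | hB'
    · rw [hBcard]; exact hle
    · exact h.card_le B' hB'
  · rw [card_insert_of_notMem hBnot]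
    exact hr
  · intro B' hB'
    rcases mem_insert.1 hB' with rfl | hB'
    · exact hBdis.mono_right subset_union_left
    · exact h.disjoint_discarded B' hB'
  · have hsub : G.interedges D (D ∪ (insert B 𝓑).biUnion id)ᶜ ⊆ G.interedges D U := by
      refine G.interedges_mono subset_rfl (compl_subset_compl.2 ?_)
      exact union_subset_union_right (biUnion_subset_biUnion_of_subset_left _ (subset_insert _ _))
    exact (Nat.cast_le.2 (card_le_card hsub)).trans h.card_interedges_le

end IsPartialMinor

/-- An expander on `n` vertices has a clique minor with `r` branch sets of size about `s ≥ √n`,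
as long as the branch sets use up only a small fraction of the vertices. -/
theorem IsEdgeExpander.le_ccl {ε : ℝ} {d s r : ℕ} (hG : G.IsEdgeExpander ε d) (hs : 0 < s)
    (hn : Fintype.card V ≤ s ^ 2) (hsn : 2 * s ≤ Fintype.card V) (hrs : r ≤ s)
    (hr : r * (21 / (ε / 8) ^ 4 * s) ≤ ε / 12 * Fintype.card V) : r ≤ G.ccl := by
  classical
  have hε := hG.c_pos
  have hε1 := hG.c_le_one
  set c := ε / 8 with hc
  have hc0 : 0 < c := by positivity
  set m : ℝ := 21 / c ^ 4 * s with hm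
  have hm0 : 0 ≤ m := by positivity
  have hd0 := hG.d_pos
  have hempty : G.IsPartialMinor c d s r m ∅ ∅ :=
    ⟨by simp, by simp, by simp, by simp, by simp, by simp, by simp, by simp, by simp⟩
  -- Discarding a branch set or some remaining vertices, and adding a branch set, all increase
  -- this weight.
  obtain ⟨⟨D, 𝓑⟩, hS, hmax⟩ := Set.exists_max_image
    {p : Finset V × Finset (Finset V) | G.IsPartialMinor c d s r m p.1 p.2}
    (fun p => 2 * #p.1 + #p.2) (Set.toFinite _) ⟨(∅, ∅), hempty⟩
  have h : G.IsPartialMinor c d s r m D 𝓑 := hS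
  suffices hrB : r ≤ #𝓑 from
    hrB.trans (le_ccl_of_finset_family 𝓑 h.connected h.disjoint h.adj)
  by_contra! hlt
  have hD := h.four_mul_card_discarded_le hG hm0 hr
  have hC := (h.card_biUnion_le hm0).trans hr
  have hC12 : 12 * #(𝓑.biUnion id) ≤ Fintype.card V := by
    have : (12 * #(𝓑.biUnion id) : ℝ) ≤ Fintype.card V := by
      have h0 : (0 : ℝ) ≤ Fintype.card V := Nat.cast_nonneg _
      nlinarith
    exact_mod_cast this
  have hBsize (B : Finset V) (hB : B ∈ 𝓑) : 12 * #B ≤ Fintype.card V := by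
    have := card_le_card (subset_biUnion_of_mem id hB)
    rw [id] at this
    omega
  have hDC : Disjoint (𝓑.biUnion id) D := by
    rw [disjoint_biUnion_left]
    exact h.disjoint_discarded
  have hUcard := card_add_card_compl (D ∪ 𝓑.biUnion id)
  have hUcard2 := card_union_le D (𝓑.biUnion id)
  have hBexp (B : Finset V) (hB : B ∈ 𝓑) :
      c * d * #B ≤ #(G.interedges B (D ∪ 𝓑.biUnion id)ᶜ) := by
    by_contra! hpoor
    have hnew := h.discard_branch hD hB (hBsize B hB) hpoor
    have hle := hmax (_, _) hnew
    have h1 := card_union_of_disjoint (h.disjoint_discarded B hB).symm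
    have h2 := card_erase_add_one hB
    have h3 := h.le_card B hB
    simp only at hle
    omega
  have hUexp := isEdgeExpander_induce (c := c) hc0 (by linarith) hd0 hG.degree_le
    (D ∪ 𝓑.biUnion id)ᶜ (by
      intro S hSU hS2
      by_contra! hpoor
      have hnew := h.discard_subset hD hSU hS2 hpoor
      have hle := hmax (_, _) hnew
      have hdis : Disjoint D S :=
        ((disjoint_compl_right (a := D ∪ 𝓑.biUnion id)).mono_right hSU).mono_left
          subset_union_left
      have h1 := card_union_of_disjoint hdis
      have h2 : 0 < #S := by
        rw [card_pos, nonempty_iff_ne_empty]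
        rintro rfl
        simp at hpoor
      simp only at hle
      omega)
  obtain ⟨B, hBnot, hnew⟩ := h.exists_add_branch hc0 hd0 hG.degree_le hs hn hrs hlt hUexp
    (by omega) hBexp
  have hle := hmax (_, _) hnew
  simp only [card_insert_of_notMem hBnot] at hle
  omega

theorem isEdgeExpander_of_le_cheegerConstant {ε : ℝ} {d : ℕ} (hε : 0 < ε) (hε1 : ε ≤ 1)
    (hd0 : 0 < d) (hd : ∀ v, G.degree v ≤ d) (hV : 2 ≤ Fintype.card V)
    (h : ε * d ≤ G.cheegerConstant) : G.IsEdgeExpander ε d := by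
  refine isEdgeExpander_of_half hε hε1 hd0 hd fun S hS => ?_
  rcases S.eq_empty_or_nonempty with rfl | hne
  · simp
  · have h1 : (#S : ℝ) ≤ (Fintype.card V : ℝ) / 2 := by
      rw [le_div_iff₀ two_pos]
      have : (2 * #S : ℝ) ≤ Fintype.card V := by exact_mod_cast hS
      linarith
    have h2 := h.trans ((isLeast_cheegerConstant G hV).2 ⟨S, hne, h1, rfl⟩)
    have h3 : (0 : ℝ) < #S := by exact_mod_cast hne.card_pos
    rwa [edgeExpansion, le_div_iff₀ h3] at h2

end

end SimpleGraph

theorem theorem2 (ε : ℝ) (hε : 0 < ε) :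
    ∃ β : ℝ, 0 < β ∧ ∃ n₀ : ℕ,
      ∀ (V : Type*) [Fintype V] [DecidableEq V] (G : SimpleGraph V) [DecidableRel G.Adj] (d : ℕ),
        n₀ ≤ Fintype.card V → 3 ≤ d → G.maxDegree ≤ d → ε * (d : ℝ) ≤ G.cheegerConstant →
          β * Real.sqrt (Fintype.card V : ℝ) ≤ (G.ccl : ℝ) := by
  set δ := min ε 1 with hδ
  have hδ0 : 0 < δ := lt_min hε one_pos
  have hδ1 : δ ≤ 1 := min_le_right _ _
  set K : ℝ := 21 / (δ / 8) ^ 4 with hK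
  have hK0 : 0 < K := by positivity
  have hK1 : 1 ≤ K := by
    rw [hK, le_div_iff₀ (by positivity), one_mul]
    have : (δ / 8) ^ 4 ≤ 1 := pow_le_one₀ (by positivity) (by linarith)
    linarith
  set β : ℝ := δ / (48 * K) with hβ
  have hβ0 : 0 < β := by positivity
  have hβ1 : β ≤ 1 := by
    rw [hβ, div_le_one (by positivity)]
    linarith
  obtain ⟨n₁, hn₁⟩ := exists_nat_ge (1 / β ^ 2)
  refine ⟨β, hβ0, max 16 n₁, fun V _ _ G _ d hn hd hmax hh => ?_⟩
  have hn16 : 16 ≤ Fintype.card V := (le_max_left _ _).trans hn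
  have hn1 : 1 / β ^ 2 ≤ Fintype.card V :=
    hn₁.trans (by exact_mod_cast (le_max_right _ _).trans hn)
  have hn16' : (16 : ℝ) ≤ Fintype.card V := by exact_mod_cast hn16
  set x := Real.sqrt (Fintype.card V : ℝ) with hx
  have hxx : x * x = Fintype.card V := Real.mul_self_sqrt (Nat.cast_nonneg _)
  have hx4 : 4 ≤ x := Real.le_sqrt_of_sq_le (by norm_num; exact hn16)
  have hβx : 1 ≤ β * x := by
    have h1 : 1 / β ≤ x := Real.le_sqrt_of_sq_le (by rw [div_pow, one_pow]; exact hn1)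
    rwa [div_le_iff₀' hβ0] at h1
  have hG : G.IsEdgeExpander δ d := by
    refine SimpleGraph.isEdgeExpander_of_le_cheegerConstant hδ0 hδ1 (by omega)
      (fun v => (G.degree_le_maxDegree v).trans hmax) (by omega) (le_trans ?_ hh)
    gcongr
    exact min_le_left _ _
  set s := ⌈x⌉₊ with hs
  set r := ⌈β * x⌉₊ with hr
  have hsx : x ≤ s := Nat.le_ceil x
  have hsx2 : (s : ℝ) ≤ 2 * x := by
    have := Nat.ceil_lt_add_one (a := x) (by linarith)
    linarith
  have hrx2 : (r : ℝ) ≤ 2 * (β * x) := by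
    have := Nat.ceil_lt_add_one (a := β * x) (by linarith)
    linarith
  have hrccl : r ≤ G.ccl := by
    refine hG.le_ccl (s := s) (r := r) ?_ ?_ ?_ ?_ ?_
    · exact Nat.ceil_pos.2 (by linarith)
    · have : (Fintype.card V : ℝ) ≤ (s : ℝ) ^ 2 := by rw [← hxx]; nlinarith
      exact_mod_cast this
    · have : (2 * s : ℝ) ≤ Fintype.card V := by rw [← hxx]; nlinarith
      exact_mod_cast this
    · exact Nat.ceil_le_ceil (by nlinarith)
    · have h1 : (r : ℝ) * (K * s) ≤ 2 * (β * x) * (K * (2 * x)) := by gcongr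
      have h2 : 2 * (β * x) * (K * (2 * x)) = δ / 12 * (x * x) := by
        rw [hβ]; field_simp; ring
      rw [h2, hxx] at h1
      exact h1
  exact (Nat.le_ceil _).trans (by exact_mod_cast hrccl)
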